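/- Let $\mathbb{S}^d=\{x\in\mathbb{R}^{d+1}:\|x\|_2=1\}$, let $\pi$ be the normalized surface measure on $\mathbb{S}^d$, and for $x\in\mathbb{S}^d$ and $-1\le t\le 1$ let $C(x,t)=\{y\in\mathbb{S}^d:\langle x,y\rangle>t\}$ be the spherical cap with center $x$ and height $t$. The spherical cap discrepancy of points $x_1,\dots,x_n\in\mathbb{S}^d$ is $$D^\ast_{\mathbb{S}^d,\mathcal{C}}(\{x_1,\dots,x_n\})=\sup_{x\in\mathbb{S}^d,\,-1\le t\le 1}\left|\frac1n\sum_{i=1}^n 1_{x_i\in C(x,t)}-\pi(C(x,t))\right|.$$ There exists an absolute constant $c>0$, independent of $n$ and $d$, such that for all integers $n\ge 1$ and $d\ge 1$ there exists a set $P_n=\{x_1,\dots,x_n\}\subset\mathbb{S}^d$ of $n$ distinct points with $$D^\ast_{\mathbb{S}^d,\mathcal{C}}(P_n)\le c\,\frac{\sqrt d+\sqrt{(d+1)\log n}}{\sqrt n}.$$ -/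

import Mathlib

open MeasureTheory

/-- The unit sphere `𝕊^d = {x ∈ ℝ^(d+1) : ‖x‖₂ = 1}`. -/
abbrev UnitSphere (d : ℕ) : Type :=
  Metric.sphere (0 : EuclideanSpace ℝ (Fin (d + 1))) 1

/-- The normalized surface measure on `𝕊^d`: the surface measure divided by its total mass. -/
noncomputable def sphereProb (d : ℕ) : Measure (UnitSphere d) :=
  ((volume : Measure (EuclideanSpace ℝ (Fin (d + 1)))).toSphere Set.univ)⁻¹ •
    (volume : Measure (EuclideanSpace ℝ (Fin (d + 1)))).toSphere

instance sphereProb_isProbabilityMeasure (d : ℕ) : IsProbabilityMeasure (sphereProb d) := by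
  unfold sphereProb
  have : NeZero ((volume : Measure (EuclideanSpace ℝ (Fin (d + 1)))).toSphere) :=
    ⟨Measure.toSphere_ne_zero _⟩
  infer_instance

/-- The open spherical cap `C(x,t) = {y ∈ 𝕊^d : ⟪x, y⟫ > t}`. -/
def sphericalCap {d : ℕ} (x : UnitSphere d) (t : ℝ) : Set (UnitSphere d) :=
  {y | inner ℝ (x : EuclideanSpace ℝ (Fin (d + 1))) (y : EuclideanSpace ℝ (Fin (d + 1))) > t}

/-- The family of all spherical caps `C(x,t)`, `x ∈ 𝕊^d`, `-1 ≤ t ≤ 1`. -/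
def sphericalCaps (d : ℕ) : Set (Set (UnitSphere d)) :=
  {C | ∃ x : UnitSphere d, ∃ t : ℝ, -1 ≤ t ∧ t ≤ 1 ∧ C = sphericalCap x t}

/-- The star-discrepancy `sup_{A ∈ 𝒜} |(1/n) ∑ᵢ 1_{xᵢ ∈ A} - π(A)|` of the points
`x₁, …, xₙ` with respect to the test sets `𝒜` and the distribution `π`. -/
noncomputable def starDiscrepancy {G : Type*} [MeasurableSpace G] (𝒜 : Set (Set G))
    (π : Measure G) {n : ℕ} (x : Fin n → G) : ℝ :=
  ⨆ A : 𝒜, |(1 / (n : ℝ)) * ∑ i, (A : Set G).indicator (fun _ => (1 : ℝ)) (x i) - π.real (A : Set G)|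

/-- The supremum defining the discrepancy is over a bounded set of reals. -/
theorem starDiscrepancy_bddAbove {G : Type*} [MeasurableSpace G] (𝒜 : Set (Set G))
    (π : Measure G) [IsProbabilityMeasure π] {n : ℕ} (x : Fin n → G) :
    BddAbove (Set.range fun A : 𝒜 =>
      |(1 / (n : ℝ)) * ∑ i, (A : Set G).indicator (fun _ => (1 : ℝ)) (x i)
        - π.real (A : Set G)|) := by
  refine ⟨1, ?_⟩
  rintro _ ⟨A, rfl⟩
  have h0 : 0 ≤ ∑ i, (A : Set G).indicator (fun _ => (1 : ℝ)) (x i) :=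
    Finset.sum_nonneg fun i _ => Set.indicator_nonneg (fun _ _ => zero_le_one) _
  have h1 : ∑ i, (A : Set G).indicator (fun _ => (1 : ℝ)) (x i) ≤ n := by
    have h : ∑ i, (A : Set G).indicator (fun _ => (1 : ℝ)) (x i) ≤ ∑ _i : Fin n, (1 : ℝ) :=
      Finset.sum_le_sum fun i _ => Set.indicator_le_self' (fun _ _ => zero_le_one) _
    simpa using h
  have h2 : 0 ≤ (1 / (n : ℝ)) * ∑ i, (A : Set G).indicator (fun _ => (1 : ℝ)) (x i) := by
    positivity
  have h3 : (1 / (n : ℝ)) * ∑ i, (A : Set G).indicator (fun _ => (1 : ℝ)) (x i) ≤ 1 := by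
    rw [one_div_mul_eq_div]
    exact div_le_one_of_le₀ h1 (Nat.cast_nonneg n)
  have h4 : π.real (A : Set G) ≤ 1 := measureReal_le_one
  have h5 : 0 ≤ π.real (A : Set G) := measureReal_nonneg
  rw [abs_le]
  constructor <;> linarith

/-! The points are drawn independently from the surface measure, and the discrepancy is controlled
through an exponential moment. A cap is the section of the sphere by an open half-space of a space
of dimension `d + 1`. By Radon's theorem such half-spaces shatter at most `d + 2` points, so by
Sauer–Shelah they cut only `(2 * n + 1) ^ (d + 2)` traces on a sample of size `2 * n`
(`card_halfspaceTraces_le`). Jensen's inequality replaces the measure of a set by its frequency in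
an independent second sample. Swapping paired points at random then turns each difference of counts
into a Rademacher sum, with subgaussian moment at most `exp (l ^ 2 * n / 2)`. Summing over traces
bounds the mean of the supremum of the `cosh` (`lintegral_iSup_cosh_centered_count_le`). Some sample
of distinct points does no worse than the mean. Taking logarithms and choosing `l` of order `√((d +
(d + 1) log n) / n)` gives the rate. -/

/-! ### Half-space traces and their number. -/

/-- The traces on the points `z i` of the open half-spaces of `E`. -/
noncomputable def halfspaceTraces {E ι : Type*} [NormedAddCommGroup E] [InnerProductSpace ℝ E]
    [Fintype ι] (z : ι → E) : Finset (Finset ι) := by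
  classical
  exact Finset.univ.filter fun T => ∃ v : E, ∃ t : ℝ, ∀ i, i ∈ T ↔ t < inner ℝ v (z i)

section Traces

variable {E ι : Type*} [NormedAddCommGroup E] [InnerProductSpace ℝ E] [Fintype ι]

theorem mem_halfspaceTraces {z : ι → E} {T : Finset ι} :
    T ∈ halfspaceTraces z ↔ ∃ v : E, ∃ t : ℝ, ∀ i, i ∈ T ↔ t < inner ℝ v (z i) := by
  classical
  simp [halfspaceTraces]

/-- Half-spaces in a space of dimension `D` shatter at most `D + 1` points. -/
theorem card_le_of_shatters_halfspaceTraces [DecidableEq ι] [FiniteDimensional ℝ E]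
    (z : ι → E) {s : Finset ι} (hs : (halfspaceTraces z).Shatters s) :
    s.card ≤ Module.finrank ℝ E + 1 := by
  classical
  by_contra! hcard
  have hdep : ¬ AffineIndependent ℝ (fun i : s => z i) := by
    intro h
    have h1 := h.card_le_finrank_succ
    have h2 := (vectorSpan ℝ (Set.range fun i : s => z i)).finrank_le
    rw [Fintype.card_coe] at h1
    omega
  -- A half-space cutting out exactly the Radon class `I` would separate the two hulls, which share
  -- the point `p`.
  obtain ⟨I, p, hpI, hpJ⟩ := Convex.radon_partition hdep
  obtain ⟨u, hu, hsu⟩ := hs (t := s.filter fun i => ∃ h : i ∈ s, (⟨i, h⟩ : s) ∈ I)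
    (Finset.filter_subset _ _)
  obtain ⟨v, t, hT⟩ := mem_halfspaceTraces.1 hu
  have key : ∀ i : s, i ∈ I ↔ t < inner ℝ v (z i) := by
    intro i
    have h := Finset.ext_iff.1 hsu i
    simp only [Finset.mem_inter, Finset.mem_filter, i.2, true_and, exists_true_left,
      Subtype.coe_eta, hT] at h
    exact h.symm
  have hlin : IsLinearMap ℝ (fun y : E => inner ℝ v y) :=
    ⟨fun a b => inner_add_right v a b, fun c a => by simp [inner_smul_right]⟩
  have h1 : convexHull ℝ ((fun i : s => z i) '' I) ⊆ {y | t < inner ℝ v y} := by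
    apply convexHull_min _ (convex_halfSpace_gt hlin t)
    rintro _ ⟨i, hi, rfl⟩
    exact (key i).1 hi
  have h2 : convexHull ℝ ((fun i : s => z i) '' Iᶜ) ⊆ {y | inner ℝ v y ≤ t} := by
    apply convexHull_min _ (convex_halfSpace_le hlin t)
    rintro _ ⟨i, hi, rfl⟩
    exact not_lt.1 fun h => hi ((key i).2 h)
  exact (not_lt.2 (show inner ℝ v p ≤ t from h2 hpJ)) (h1 hpI)

/-- Termwise comparison with the binomial expansion of the right side, using `m.choose k ≤ m ^ k`.
-/
theorem sum_choose_le_add_one_pow (m D : ℕ) :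
    ∑ k ∈ Finset.Iic D, m.choose k ≤ (m + 1) ^ D := by
  have h : Finset.Iic D = Finset.range (D + 1) := by ext; simp
  rw [add_pow, h]
  refine Finset.sum_le_sum fun k hk => ?_
  have hk' : 0 < D.choose k := Nat.choose_pos (Nat.lt_succ_iff.1 (Finset.mem_range.1 hk))
  calc m.choose k ≤ m ^ k := Nat.choose_le_pow m k
    _ ≤ m ^ k * 1 ^ (D - k) * D.choose k := by
      rw [one_pow, mul_one]; exact Nat.le_mul_of_pos_right _ hk'

theorem card_halfspaceTraces_le [FiniteDimensional ℝ E] (z : ι → E) :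
    (halfspaceTraces z).card ≤ (Fintype.card ι + 1) ^ (Module.finrank ℝ E + 1) := by
  classical
  have hvc : (halfspaceTraces z).vcDim ≤ Module.finrank ℝ E + 1 :=
    Finset.sup_le fun s hs =>
      card_le_of_shatters_halfspaceTraces z (Finset.mem_shatterer.1 hs)
  calc (halfspaceTraces z).card ≤ (halfspaceTraces z).shatterer.card :=
        Finset.card_le_card_shatterer _
    _ ≤ ∑ k ∈ Finset.Iic (halfspaceTraces z).vcDim, (Fintype.card ι).choose k :=
        Finset.card_shatterer_le_sum_vcDim
    _ ≤ (Fintype.card ι + 1) ^ (halfspaceTraces z).vcDim := sum_choose_le_add_one_pow _ _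
    _ ≤ _ := Nat.pow_le_pow_right (Nat.succ_pos _) hvc

end Traces

/-! ### Exponential moments of Rademacher sums. -/

/-- The sign `1` or `-1` attached to a Boolean. -/
def rademacherSign (b : Bool) : ℝ := if b then 1 else -1

/-- The sum over sign patterns factors into a product of `2 * cosh (l * a i)`, and `cosh t ≤ exp (t
^ 2 / 2)`. -/
theorem sum_exp_rademacher_le {n : ℕ} (l : ℝ) (a : Fin n → ℝ) (ha : ∀ i, |a i| ≤ 1) :
    ∑ s : Fin n → Bool, Real.exp (l * ∑ i, rademacherSign (s i) * a i) ≤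
      2 ^ n * Real.exp (l ^ 2 * n / 2) := by
  have h1 : ∀ s : Fin n → Bool, Real.exp (l * ∑ i, rademacherSign (s i) * a i) =
      ∏ i, Real.exp (l * (rademacherSign (s i) * a i)) := by
    intro s
    rw [Finset.mul_sum, Real.exp_sum]
  simp_rw [h1]
  have h2 := Finset.sum_prod_piFinset (ι := Fin n) (Finset.univ : Finset Bool)
    (fun i b => Real.exp (l * (rademacherSign b * a i)))
  rw [Fintype.piFinset_univ] at h2
  rw [h2]
  calc ∏ i, ∑ b : Bool, Real.exp (l * (rademacherSign b * a i))
      ≤ ∏ _i : Fin n, 2 * Real.exp (l ^ 2 / 2) := by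
        refine Finset.prod_le_prod (fun i _ => by positivity) fun i _ => ?_
        have h3 : ∑ b : Bool, Real.exp (l * (rademacherSign b * a i)) =
            2 * Real.cosh (l * a i) := by
          rw [Fintype.sum_bool, Real.cosh_eq]
          simp [rademacherSign]
          ring
        have h4 : (l * a i) ^ 2 ≤ l ^ 2 := by
          have h5 : a i ^ 2 ≤ 1 := by
            rw [← sq_abs]
            exact pow_le_one₀ (abs_nonneg _) (ha i)
          rw [mul_pow]
          exact mul_le_of_le_one_right (sq_nonneg l) h5
        rw [h3]
        gcongr
        exact (Real.cosh_le_exp_half_sq _).trans (Real.exp_le_exp.2 (by linarith))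
    _ = 2 ^ n * Real.exp (l ^ 2 * n / 2) := by
        rw [Finset.prod_const, Finset.card_univ, Fintype.card_fin, mul_pow, ← Real.exp_nat_mul]
        ring_nf

theorem sum_cosh_rademacher_le {n : ℕ} (l : ℝ) (a : Fin n → ℝ) (ha : ∀ i, |a i| ≤ 1) :
    ∑ s : Fin n → Bool, Real.cosh (l * ∑ i, rademacherSign (s i) * a i) ≤
      2 ^ n * Real.exp (l ^ 2 * n / 2) := by
  have h1 := sum_exp_rademacher_le l a ha
  have h2 := sum_exp_rademacher_le (-l) a ha
  simp_rw [Real.cosh_eq, ← neg_mul]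
  rw [← Finset.sum_div, Finset.sum_add_distrib]
  rw [neg_sq] at h2
  linarith

/-- A union bound in moment form: a maximum over traces is dominated by the sum over them, so their
number enters only as the factor `N`. -/
theorem sum_le_of_le_sum_cosh {n N : ℕ} {τ : Type*} (l : ℝ) (P : Finset τ) (hP : P.card ≤ N)
    (a : τ → Fin n → ℝ) (ha : ∀ T i, |a T i| ≤ 1) (f : (Fin n → Bool) → ENNReal)
    (hle : ∀ s, f s ≤ ∑ T ∈ P,
      ENNReal.ofReal (Real.cosh (l * ∑ i, rademacherSign (s i) * a T i))) :
    ∑ s, f s ≤ ENNReal.ofReal (2 ^ n * (N * Real.exp (l ^ 2 * n / 2))) := by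
  calc ∑ s, f s
      ≤ ∑ s : Fin n → Bool, ∑ T ∈ P, ENNReal.ofReal (Real.cosh (l * ∑ i, rademacherSign (s i) * a T i)) :=
        Finset.sum_le_sum fun s _ => hle s
    _ = ∑ T ∈ P, ENNReal.ofReal
          (∑ s : Fin n → Bool, Real.cosh (l * ∑ i, rademacherSign (s i) * a T i)) := by
        rw [Finset.sum_comm]
        refine Finset.sum_congr rfl fun T _ => ?_
        rw [ENNReal.ofReal_sum_of_nonneg fun s _ => (Real.cosh_pos _).le]
    _ ≤ ∑ _T ∈ P, ENNReal.ofReal (2 ^ n * Real.exp (l ^ 2 * n / 2)) :=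
        Finset.sum_le_sum fun T _ =>
          ENNReal.ofReal_le_ofReal (sum_cosh_rademacher_le l (a T) (ha T))
    _ = ENNReal.ofReal (P.card * (2 ^ n * Real.exp (l ^ 2 * n / 2))) := by
        rw [Finset.sum_const, nsmul_eq_mul, ENNReal.ofReal_mul (Nat.cast_nonneg _),
          ENNReal.ofReal_natCast]
    _ ≤ ENNReal.ofReal (2 ^ n * (N * Real.exp (l ^ 2 * n / 2))) := by
        refine ENNReal.ofReal_le_ofReal ?_
        have hc : (P.card : ℝ) ≤ N := by exact_mod_cast hP
        calc (P.card : ℝ) * (2 ^ n * Real.exp (l ^ 2 * n / 2))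
            ≤ N * (2 ^ n * Real.exp (l ^ 2 * n / 2)) := by gcongr
          _ = _ := by ring

/-! ### Symmetrization by a second sample. -/

section Symmetrization

variable {G κ : Type*} [MeasurableSpace G] {n : ℕ}

/-- Randomly swapping the two halves of a double sample bounds the exponential moment of the
largest difference of the two counts by the number of traces of the family on the sample. -/
theorem lintegral_iSup_cosh_sub_le [Countable κ] (μ : Measure G) [IsProbabilityMeasure μ]
    (A : κ → Set G) (hA : ∀ k, MeasurableSet (A k)) (N : ℕ)
    (hN : ∀ z : Fin n × Bool → G, ∃ P : Finset (Finset (Fin n × Bool)), P.card ≤ N ∧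
      ∀ k, ∃ T ∈ P, ∀ i, i ∈ T ↔ z i ∈ A k) (l : ℝ) :
    ∫⁻ z : Fin n → G × G, ⨆ k, ENNReal.ofReal (Real.cosh (l * ∑ i,
        ((A k).indicator (fun _ => (1 : ℝ)) (z i).1 - (A k).indicator (fun _ => 1) (z i).2)))
        ∂Measure.pi (fun _ => μ.prod μ) ≤
      ENNReal.ofReal (N * Real.exp (l ^ 2 * n / 2)) := by
  classical
  set F : (Fin n → G × G) → ENNReal := fun z => ⨆ k, ENNReal.ofReal (Real.cosh (l * ∑ i,
        ((A k).indicator (fun _ => (1 : ℝ)) (z i).1 - (A k).indicator (fun _ => 1) (z i).2)))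
  have hind : ∀ k, Measurable ((A k).indicator (fun _ => (1 : ℝ))) := fun k =>
    measurable_const.indicator (hA k)
  have hFm : Measurable F := by
    refine Measurable.iSup fun k => ENNReal.measurable_ofReal.comp
      (Real.continuous_cosh.measurable.comp (measurable_const.mul
        (Finset.measurable_sum _ fun i _ => ?_)))
    exact ((hind k).comp (measurable_fst.comp (measurable_pi_apply i))).sub
      ((hind k).comp (measurable_snd.comp (measurable_pi_apply i)))
  -- The swap at `i` reverses the sign of the `i`-th difference and preserves the product measure,
  -- so averaging over all `s` leaves the integral unchanged.
  let w : (Fin n → Bool) → (Fin n → G × G) → (Fin n → G × G) := fun s z i =>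
    (if s i then id else Prod.swap) (z i)
  have hw : ∀ s, MeasurePreserving (w s) (Measure.pi fun _ => μ.prod μ)
      (Measure.pi fun _ => μ.prod μ) := by
    intro s
    refine measurePreserving_pi (fun _ => μ.prod μ) (fun _ => μ.prod μ)
      (f := fun i => if s i then id else Prod.swap) fun i => ?_
    by_cases h : s i
    · simpa [h] using MeasurePreserving.id (μ.prod μ)
    · simpa [h] using Measure.measurePreserving_swap (μ := μ) (ν := μ)
  have hpt : ∀ z, ∑ s, F (w s z) ≤ ENNReal.ofReal (2 ^ n * (N * Real.exp (l ^ 2 * n / 2))) := by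
    intro z
    -- The traces are taken on the unswapped double sample, so one collection `P` serves all sign
    -- patterns.
    obtain ⟨P, hP, hT⟩ := hN fun i => if i.2 then (z i.1).1 else (z i.1).2
    let a : Finset (Fin n × Bool) → Fin n → ℝ := fun T i =>
      (if (i, true) ∈ T then 1 else 0) - (if (i, false) ∈ T then 1 else 0)
    have ha : ∀ T i, |a T i| ≤ 1 := by
      intro T i
      simp only [a]
      split_ifs <;> norm_num
    have hle : ∀ s, F (w s z) ≤ ∑ T ∈ P,
        ENNReal.ofReal (Real.cosh (l * ∑ i, rademacherSign (s i) * a T i)) := by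
      intro s
      refine iSup_le fun k => ?_
      obtain ⟨T, hTP, hTk⟩ := hT k
      refine le_trans (le_of_eq ?_) (Finset.single_le_sum
        (f := fun T => ENNReal.ofReal (Real.cosh (l * ∑ i, rademacherSign (s i) * a T i)))
        (fun _ _ => zero_le) hTP)
      congr 3
      refine Finset.sum_congr rfl fun i _ => ?_
      have e1 : (A k).indicator (fun _ => (1 : ℝ)) (z i).1 =
          if (i, true) ∈ T then 1 else 0 := by
        simp [Set.indicator_apply, hTk (i, true)]
      have e2 : (A k).indicator (fun _ => (1 : ℝ)) (z i).2 =
          if (i, false) ∈ T then 1 else 0 := by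
        simp [Set.indicator_apply, hTk (i, false)]
      by_cases h : s i
      · simp only [w, h, if_true, id, e1, e2, rademacherSign, a, one_mul]
      · simp only [w, h, Bool.false_eq_true, if_false, Prod.fst_swap, Prod.snd_swap, e1, e2,
          rademacherSign, a]
        ring
    exact sum_le_of_le_sum_cosh l P hP a ha _ hle
  have hsum : (2 : ENNReal) ^ n * ∫⁻ z, F z ∂Measure.pi (fun _ => μ.prod μ) =
      ∫⁻ z, ∑ s, F (w s z) ∂Measure.pi (fun _ => μ.prod μ) := by
    rw [lintegral_finsetSum (f := fun s z => F (w s z)) _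
      fun s _ => hFm.comp (hw s).measurable]
    simp_rw [(hw _).lintegral_comp hFm]
    simp
  have hfin : (2 : ENNReal) ^ n * ∫⁻ z, F z ∂Measure.pi (fun _ => μ.prod μ) ≤
      2 ^ n * ENNReal.ofReal (N * Real.exp (l ^ 2 * n / 2)) := by
    rw [hsum]
    calc ∫⁻ z, ∑ s, F (w s z) ∂Measure.pi (fun _ => μ.prod μ)
        ≤ ∫⁻ _z, ENNReal.ofReal (2 ^ n * (N * Real.exp (l ^ 2 * n / 2)))
            ∂Measure.pi (fun _ : Fin n => μ.prod μ) := lintegral_mono hpt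
      _ = _ := by
          rw [lintegral_const, measure_univ, mul_one, ENNReal.ofReal_mul (by positivity),
            ENNReal.ofReal_pow (by norm_num)]
          simp
  exact (ENNReal.mul_le_mul_iff_right (by simp) (by finiteness)).1 hfin

/-- Jensen's inequality for the centred count against an independent copy of the sample. -/
theorem cosh_centered_count_le_integral (μ : Measure G) [IsProbabilityMeasure μ]
    {A : Set G} (hA : MeasurableSet A) (l : ℝ) (x : Fin n → G) :
    ENNReal.ofReal (Real.cosh (l * ∑ i, (A.indicator (fun _ => (1 : ℝ)) (x i) - μ.real A))) ≤
      ∫⁻ y, ENNReal.ofReal (Real.cosh (l * ∑ i,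
        (A.indicator (fun _ => (1 : ℝ)) (x i) - A.indicator (fun _ => 1) (y i))))
        ∂Measure.pi (fun _ => μ) := by
  set g : (Fin n → G) → ℝ := fun y => ∑ i,
    (A.indicator (fun _ => (1 : ℝ)) (x i) - A.indicator (fun _ => 1) (y i)) with hg
  have hind : Measurable (A.indicator (fun _ => (1 : ℝ))) := measurable_const.indicator hA
  have hgm : Measurable g := Finset.measurable_sum _ fun i _ =>
    measurable_const.sub (hind.comp (measurable_pi_apply i))
  have hgb : ∀ y, |g y| ≤ n := by
    intro y
    calc |g y| ≤ ∑ i : Fin n,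
          |A.indicator (fun _ => (1 : ℝ)) (x i) - A.indicator (fun _ => 1) (y i)| :=
          Finset.abs_sum_le_sum_abs _ _
      _ ≤ ∑ _i : Fin n, (1 : ℝ) := Finset.sum_le_sum fun i _ => by
          by_cases h1 : x i ∈ A <;> by_cases h2 : y i ∈ A <;> simp [h1, h2]
      _ = n := by simp
  have hii : ∀ i : Fin n, Integrable (fun y : Fin n → G => A.indicator (fun _ => (1 : ℝ)) (y i))
      (Measure.pi fun _ => μ) := fun i =>
    Integrable.of_bound (hind.comp (measurable_pi_apply i)).aestronglyMeasurable 1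
      (ae_of_all _ fun y => by
        by_cases h1 : y i ∈ A <;> simp [h1])
  have hint : ∫ y, g y ∂Measure.pi (fun _ => μ) =
      ∑ i, (A.indicator (fun _ => (1 : ℝ)) (x i) - μ.real A) := by
    simp only [hg]
    rw [integral_finsetSum (f := fun (i : Fin n) (y : Fin n → G) =>
      A.indicator (fun _ => (1 : ℝ)) (x i) - A.indicator (fun _ => 1) (y i)) _
      fun i _ => (integrable_const _).sub (hii i)]
    refine Finset.sum_congr rfl fun i _ => ?_
    rw [integral_sub (integrable_const _) (hii i), integral_const,
      integral_comp_eval (μ := fun _ : Fin n => μ) (i := i)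
        (f := A.indicator (fun _ => (1 : ℝ))) hind.aestronglyMeasurable]
    simp [integral_indicator hA]
  have hgi : Integrable g (Measure.pi fun _ => μ) :=
    integrable_finsetSum _ fun i _ => (integrable_const _).sub (hii i)
  have hei : ∀ l : ℝ, Integrable (fun y => Real.exp (l * g y)) (Measure.pi fun _ => μ) := by
    intro l
    refine Integrable.of_bound (C := Real.exp (|l| * n))
      (Real.measurable_exp.comp (measurable_const.mul hgm)).aestronglyMeasurable
      (ae_of_all _ fun y => ?_)
    rw [Real.norm_eq_abs, Real.abs_exp]
    refine Real.exp_le_exp.2 ((le_abs_self _).trans ?_)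
    rw [abs_mul]
    gcongr
    exact hgb y
  -- Jensen is applied to `exp` at `l` and at `-l`; averaging the two gives it for `cosh`.
  have hjen : ∀ l : ℝ, Real.exp (l * ∫ y, g y ∂Measure.pi (fun _ => μ)) ≤
      ∫ y, Real.exp (l * g y) ∂Measure.pi (fun _ => μ) := by
    intro l
    rw [← integral_const_mul]
    exact convexOn_exp.map_integral_le Real.continuous_exp.continuousOn isClosed_univ
      (ae_of_all _ fun _ => Set.mem_univ _) (hgi.const_mul l) (hei l)
  have hcosh : (fun y => Real.cosh (l * g y)) =
      fun y => (Real.exp (l * g y) + Real.exp (-l * g y)) / 2 := by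
    funext y
    rw [Real.cosh_eq, neg_mul]
  have hci : Integrable (fun y => Real.cosh (l * g y)) (Measure.pi fun _ => μ) := by
    rw [hcosh]
    exact ((hei l).add (hei (-l))).div_const 2
  rw [← hint, ← ofReal_integral_eq_lintegral_ofReal hci
    (ae_of_all _ fun _ => (Real.cosh_pos _).le)]
  refine ENNReal.ofReal_le_ofReal ?_
  rw [hcosh, integral_div, integral_add (hei l) (hei (-l)), Real.cosh_eq]
  have h1 := hjen l
  have h2 := hjen (-l)
  rw [neg_mul] at h2
  linarith

theorem lintegral_iSup_cosh_centered_count_le [Countable κ] (μ : Measure G)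
    [IsProbabilityMeasure μ] (A : κ → Set G) (hA : ∀ k, MeasurableSet (A k)) (N : ℕ)
    (hN : ∀ z : Fin n × Bool → G, ∃ P : Finset (Finset (Fin n × Bool)), P.card ≤ N ∧
      ∀ k, ∃ T ∈ P, ∀ i, i ∈ T ↔ z i ∈ A k) (l : ℝ) :
    ∫⁻ x : Fin n → G, ⨆ k, ENNReal.ofReal (Real.cosh (l * ∑ i,
        ((A k).indicator (fun _ => (1 : ℝ)) (x i) - μ.real (A k))))
        ∂Measure.pi (fun _ => μ) ≤
      ENNReal.ofReal (N * Real.exp (l ^ 2 * n / 2)) := by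
  set H : (Fin n → G) × (Fin n → G) → ENNReal := fun p =>
    ⨆ k, ENNReal.ofReal (Real.cosh (l * ∑ i,
      ((A k).indicator (fun _ => (1 : ℝ)) (p.1 i) - (A k).indicator (fun _ => 1) (p.2 i))))
  have hind : ∀ k, Measurable ((A k).indicator (fun _ => (1 : ℝ))) := fun k =>
    measurable_const.indicator (hA k)
  have hHm : Measurable H := by
    refine Measurable.iSup fun k => ENNReal.measurable_ofReal.comp
      (Real.continuous_cosh.measurable.comp (measurable_const.mul
        (Finset.measurable_sum _ fun i _ => ?_)))
    exact ((hind k).comp ((measurable_pi_apply i).comp measurable_fst)).sub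
      ((hind k).comp ((measurable_pi_apply i).comp measurable_snd))
  calc _ ≤ ∫⁻ x : Fin n → G, ∫⁻ y : Fin n → G, H (x, y) ∂Measure.pi (fun _ => μ)
          ∂Measure.pi (fun _ => μ) := by
        refine lintegral_mono fun x => iSup_le fun k => ?_
        refine (cosh_centered_count_le_integral μ (hA k) l x).trans
          (lintegral_mono fun y => ?_)
        exact le_iSup (fun k => ENNReal.ofReal (Real.cosh (l * ∑ i,
          ((A k).indicator (fun _ => (1 : ℝ)) (x i) - (A k).indicator (fun _ => 1) (y i))))) k
    _ = ∫⁻ p, H p ∂((Measure.pi fun _ => μ).prod (Measure.pi fun _ => μ)) :=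
        (lintegral_prod _ hHm.aemeasurable).symm
    _ = ∫⁻ z, H (MeasurableEquiv.arrowProdEquivProdArrow G G (Fin n) z)
          ∂Measure.pi (fun _ => μ.prod μ) :=
        ((measurePreserving_arrowProdEquivProdArrow G G (Fin n) (fun _ => μ)
          (fun _ => μ)).lintegral_comp hHm).symm
    _ ≤ _ := lintegral_iSup_cosh_sub_le μ A hA N hN l

end Symmetrization

/-! ### Almost sure distinctness of the sample. -/

open Pointwise in
instance toSphere_nullSingletonClass (d : ℕ) [NeZero d] :
    NullSingletonClass (volume : Measure (EuclideanSpace ℝ (Fin (d + 1)))).toSphere where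
  measure_singleton x := by
    rw [Measure.toSphere_apply' _ (measurableSet_singleton x)]
    have hspan : (Submodule.span ℝ {(x : EuclideanSpace ℝ (Fin (d + 1)))}) ≠ ⊤ := by
      intro h
      have h1 := finrank_span_le_card (R := ℝ) {(x : EuclideanSpace ℝ (Fin (d + 1)))}
      rw [h, finrank_top, finrank_euclideanSpace, Fintype.card_fin, Set.toFinset_singleton,
        Finset.card_singleton] at h1
      have := NeZero.ne d
      omega
    have h0 := Measure.addHaar_submodule (volume : Measure (EuclideanSpace ℝ (Fin (d + 1)))) _ hspan
    -- The surface measure of a point is a multiple of the volume of the segment below it, which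
    -- lies in a line, a proper subspace since `d ≥ 1`.
    have hsub : Set.Ioo (0 : ℝ) 1 •
        (Subtype.val '' ({x} : Set (UnitSphere d)) : Set (EuclideanSpace ℝ (Fin (d + 1)))) ⊆
        (Submodule.span ℝ {(x : EuclideanSpace ℝ (Fin (d + 1)))} :
          Set (EuclideanSpace ℝ (Fin (d + 1)))) := by
      rintro _ ⟨r, _, _, ⟨y, rfl, rfl⟩, rfl⟩
      exact Submodule.smul_mem _ _ (Submodule.mem_span_singleton_self _)
    rw [measure_mono_null hsub h0, mul_zero]

instance sphereProb_nullSingletonClass (d : ℕ) [NeZero d] : NullSingletonClass (sphereProb d) where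
  measure_singleton x := by rw [sphereProb, Measure.smul_apply, measure_singleton, smul_zero]

/-- Independent samples of an atomless distribution are almost surely distinct. -/
theorem measure_pi_not_injective {G : Type*} [MeasurableSpace G] [MeasurableEq G]
    (μ : Measure G) [IsProbabilityMeasure μ] [NullSingletonClass μ] (n : ℕ) :
    Measure.pi (fun _ : Fin n => μ) {x | ¬ Function.Injective x} = 0 := by
  have hsub : {x : Fin n → G | ¬ Function.Injective x} ⊆
      ⋃ p : {p : Fin n × Fin n // p.1 ≠ p.2}, {x | x p.1.1 = x p.1.2} := by
    intro x hx
    simp only [Set.mem_ofPred_eq, Function.Injective, not_forall] at hx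
    obtain ⟨i, j, hij, hne⟩ := hx
    exact Set.mem_iUnion.2 ⟨⟨(i, j), hne⟩, hij⟩
  refine measure_mono_null hsub (measure_iUnion_null ?_)
  rintro ⟨⟨i, j⟩, hij⟩
  have hind := (ProbabilityTheory.iIndepFun_pi (μ := fun _ : Fin n => μ)
    (X := fun _ => (id : G → G)) fun _ => aemeasurable_id).indepFun hij
  have hmap := (ProbabilityTheory.indepFun_iff_map_prod_eq_prod_map_map
    (measurable_pi_apply i).aemeasurable (measurable_pi_apply j).aemeasurable).1 hind
  rw [(measurePreserving_eval (fun _ : Fin n => μ) i).map_eq,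
    (measurePreserving_eval (fun _ : Fin n => μ) j).map_eq] at hmap
  have hdiag : (μ.prod μ) (Set.diagonal G) = 0 := by
    rw [Measure.measure_prod_null measurableSet_diagonal]
    refine ae_of_all _ fun a => ?_
    have : Prod.mk a ⁻¹' Set.diagonal G = {a} := by
      ext b; simp [eq_comm]
    simp [this]
  rw [← hmap, Measure.map_apply (by fun_prop) measurableSet_diagonal] at hdiag
  exact hdiag

/-! ### Reduction to countably many half-spaces. -/

/-- The part of the sphere in the open half-space `{y | ⟪v, y⟫ > t}`. -/
def sphereHalfspace {d : ℕ} (p : EuclideanSpace ℝ (Fin (d + 1)) × ℝ) : Set (UnitSphere d) :=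
  {y | p.2 < inner ℝ p.1 (y : EuclideanSpace ℝ (Fin (d + 1)))}

theorem measurableSet_sphereHalfspace {d : ℕ} (p : EuclideanSpace ℝ (Fin (d + 1)) × ℝ) :
    MeasurableSet (sphereHalfspace p) :=
  (isOpen_lt continuous_const (continuous_const.inner continuous_subtype_val)).measurableSet

open Filter Topology in
/-- Every half-space section of the sphere is a pointwise limit of sections from a dense family. -/
theorem exists_tendsto_sphereHalfspace {d : ℕ}
    {u : ℕ → EuclideanSpace ℝ (Fin (d + 1)) × ℝ} (hu : DenseRange u)
    (p : EuclideanSpace ℝ (Fin (d + 1)) × ℝ) :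
    ∃ k : ℕ → ℕ, ∀ y : UnitSphere d,
      ∀ᶠ m in atTop, y ∈ sphereHalfspace (u (k m)) ↔ y ∈ sphereHalfspace p := by
  -- With `ε = 1 / (m + 1)`, inner products with unit vectors move by less than `ε`. Raising the
  -- threshold by more than `ε` keeps boundary points excluded; raising it by less than `2 * ε`
  -- retains points with margin at least `3 * ε`.
  have hex : ∀ m : ℕ, ∃ j, ‖(u j).1 - p.1‖ < 1 / ((m : ℝ) + 1) ∧
      p.2 + 1 / ((m : ℝ) + 1) < (u j).2 ∧ (u j).2 < p.2 + 2 * (1 / ((m : ℝ) + 1)) := by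
    intro m
    have hm : (0 : ℝ) < 1 / ((m : ℝ) + 1) := by positivity
    have hopen : IsOpen (Metric.ball p.1 (1 / ((m : ℝ) + 1)) ×ˢ
        Set.Ioo (p.2 + 1 / ((m : ℝ) + 1)) (p.2 + 2 * (1 / ((m : ℝ) + 1)))) :=
      Metric.isOpen_ball.prod isOpen_Ioo
    obtain ⟨j, hj⟩ := hu.exists_mem_open hopen
      ⟨(p.1, p.2 + 3 / 2 * (1 / ((m : ℝ) + 1))), Metric.mem_ball_self hm, by
        constructor <;> dsimp only <;> linarith⟩
    exact ⟨j, by simpa [dist_eq_norm] using hj.1, hj.2.1, hj.2.2⟩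
  choose k hk1 hk2 hk3 using hex
  refine ⟨k, fun y => ?_⟩
  have hinner : ∀ m, |inner ℝ (u (k m)).1 (y : EuclideanSpace ℝ (Fin (d + 1))) -
      inner ℝ p.1 (y : EuclideanSpace ℝ (Fin (d + 1)))| < 1 / ((m : ℝ) + 1) := by
    intro m
    rw [← inner_sub_left]
    have hy : ‖(y : EuclideanSpace ℝ (Fin (d + 1)))‖ = 1 := by simp
    have := abs_real_inner_le_norm ((u (k m)).1 - p.1) (y : EuclideanSpace ℝ (Fin (d + 1)))
    rw [hy, mul_one] at this
    exact this.trans_lt (hk1 m)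
  by_cases hy : y ∈ sphereHalfspace p
  · have hy' : 0 < inner ℝ p.1 (y : EuclideanSpace ℝ (Fin (d + 1))) - p.2 := sub_pos.2 hy
    have hlim : Tendsto (fun m : ℕ => 3 * (1 / ((m : ℝ) + 1))) atTop (𝓝 0) := by
      simpa using (tendsto_one_div_add_atTop_nhds_zero_nat (𝕜 := ℝ)).const_mul 3
    filter_upwards [hlim.eventually_lt_const hy'] with m hm
    refine iff_of_true ?_ hy
    change (u (k m)).2 < inner ℝ (u (k m)).1 (y : EuclideanSpace ℝ (Fin (d + 1)))
    have := (abs_lt.1 (hinner m)).1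
    linarith [hk3 m]
  · refine Eventually.of_forall fun m => iff_of_false ?_ hy
    have hy' : inner ℝ p.1 (y : EuclideanSpace ℝ (Fin (d + 1))) ≤ p.2 := not_lt.1 hy
    refine not_lt.2 (show inner ℝ (u (k m)).1 (y : EuclideanSpace ℝ (Fin (d + 1))) ≤
      (u (k m)).2 from ?_)
    have := (abs_lt.1 (hinner m)).2
    linarith [hk2 m]

open Filter Topology in
/-- A bound on the centred counts over a dense family of half-spaces holds for all of them. -/
theorem abs_centered_count_le_of_dense {d n : ℕ}
    {u : ℕ → EuclideanSpace ℝ (Fin (d + 1)) × ℝ} (hu : DenseRange u)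
    (x : Fin n → UnitSphere d) (B : ℝ)
    (hB : ∀ k, |∑ i, ((sphereHalfspace (u k)).indicator (fun _ => (1 : ℝ)) (x i) -
      (sphereProb d).real (sphereHalfspace (u k)))| ≤ B)
    (p : EuclideanSpace ℝ (Fin (d + 1)) × ℝ) :
    |∑ i, ((sphereHalfspace p).indicator (fun _ => (1 : ℝ)) (x i) -
      (sphereProb d).real (sphereHalfspace p))| ≤ B := by
  obtain ⟨k, hk⟩ := exists_tendsto_sphereHalfspace hu p
  have hmeas : Tendsto (fun m => (sphereProb d).real (sphereHalfspace (u (k m)))) atTop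
      (𝓝 ((sphereProb d).real (sphereHalfspace p))) :=
    (ENNReal.tendsto_toReal (measure_ne_top _ _)).comp
      (tendsto_measure_of_tendsto_indicator_of_isFiniteMeasure atTop (sphereProb d)
        (fun m => measurableSet_sphereHalfspace (u (k m))) hk)
  have hind : ∀ i, Tendsto (fun m =>
      (sphereHalfspace (u (k m))).indicator (fun _ => (1 : ℝ)) (x i)) atTop
      (𝓝 ((sphereHalfspace p).indicator (fun _ => (1 : ℝ)) (x i))) := by
    intro i
    refine tendsto_const_nhds.congr' ?_
    filter_upwards [hk (x i)] with m hm
    by_cases h : x i ∈ sphereHalfspace p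
    · simp [h, hm.2 h]
    · simp [h, mt hm.1 h]
  exact le_of_tendsto (tendsto_finsetSum _ fun i _ => (hind i).sub hmeas).abs
    (Eventually.of_forall fun m => hB (k m))

/-! ### Choice of the sample and of the parameter. -/

/-- Some `n` distinct points of the sphere have all centred half-space counts controlled by the
exponential moment with parameter `l`. -/
theorem exists_injective_abs_centered_count_le (n d : ℕ) [NeZero d] {l : ℝ} (hl : 0 < l) :
    ∃ x : Fin n → UnitSphere d, Function.Injective x ∧
      ∀ p, |∑ i, ((sphereHalfspace p).indicator (fun _ => (1 : ℝ)) (x i) -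
        (sphereProb d).real (sphereHalfspace p))| ≤
        (Real.log (2 * (2 * n + 1) ^ (d + 2)) + l ^ 2 * n / 2) / l := by
  set u := TopologicalSpace.denseSeq (EuclideanSpace ℝ (Fin (d + 1)) × ℝ)
  have hu : DenseRange u := TopologicalSpace.denseRange_denseSeq _
  have hmom := lintegral_iSup_cosh_centered_count_le (n := n) (sphereProb d)
    (fun k => sphereHalfspace (u k)) (fun k => measurableSet_sphereHalfspace (u k))
    ((2 * n + 1) ^ (d + 2)) (by
      intro z
      refine ⟨halfspaceTraces fun i => (z i : EuclideanSpace ℝ (Fin (d + 1))), ?_, fun k => ?_⟩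
      · refine (card_halfspaceTraces_le _).trans (le_of_eq ?_)
        simp [mul_comm]
      · classical
        refine ⟨Finset.univ.filter fun i => z i ∈ sphereHalfspace (u k),
          mem_halfspaceTraces.2 ⟨(u k).1, (u k).2, fun i => ?_⟩, fun i => ?_⟩
        · rw [Finset.mem_filter_univ]; rfl
        · simp) l
  have hind : ∀ k, Measurable ((sphereHalfspace (u k)).indicator (fun _ => (1 : ℝ))) := fun k =>
    measurable_const.indicator (measurableSet_sphereHalfspace (u k))
  obtain ⟨x, hx, hxle⟩ := exists_notMem_null_le_lintegral
    (μ := Measure.pi fun _ : Fin n => sphereProb d)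
    (f := fun x => ⨆ k, ENNReal.ofReal (Real.cosh (l * ∑ i,
        ((sphereHalfspace (u k)).indicator (fun _ => (1 : ℝ)) (x i) -
          (sphereProb d).real (sphereHalfspace (u k))))))
    (Measurable.iSup fun k => ENNReal.measurable_ofReal.comp
      (Real.continuous_cosh.measurable.comp (measurable_const.mul
        (Finset.measurable_sum _ fun i _ =>
          ((hind k).comp (measurable_pi_apply i)).sub measurable_const)))).aemeasurable
    (measure_pi_not_injective (sphereProb d) n)
  refine ⟨x, not_not.1 hx, abs_centered_count_le_of_dense hu x _ fun k => ?_⟩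
  have h1 := (le_iSup (fun k => ENNReal.ofReal (Real.cosh (l * ∑ i,
        ((sphereHalfspace (u k)).indicator (fun _ => (1 : ℝ)) (x i) -
          (sphereProb d).real (sphereHalfspace (u k)))))) k).trans (hxle.trans hmom)
  set Z := ∑ i, ((sphereHalfspace (u k)).indicator (fun _ => (1 : ℝ)) (x i) -
          (sphereProb d).real (sphereHalfspace (u k)))
  rw [ENNReal.ofReal_le_ofReal_iff (by positivity), ← Real.cosh_abs, abs_mul, abs_of_pos hl,
    Real.cosh_eq] at h1
  -- The bound `cosh t ≥ exp t / 2` costs the factor `2` inside the logarithm.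
  have h2 : Real.exp (l * |Z|) ≤
      2 * (2 * n + 1) ^ (d + 2) * Real.exp (l ^ 2 * n / 2) := by
    have h3 := Real.exp_pos (-(l * |Z|))
    push_cast at h1
    linarith
  have h4 := Real.log_le_log (Real.exp_pos _) h2
  rw [Real.log_exp, Real.log_mul (by positivity) (by positivity), Real.log_exp] at h4
  rw [le_div_iff₀ hl]
  linarith

/-- The hypothesis `1 ≤ d` absorbs the additive constants; `9` is a convenient constant, not an
optimal one. -/
theorem log_two_mul_pow_le {n d : ℕ} (hn : 1 ≤ n) (hd : 1 ≤ d) :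
    Real.log (2 * (2 * n + 1) ^ (d + 2)) ≤ 9 * (d + (d + 1) * Real.log n) := by
  have hn' : (1 : ℝ) ≤ n := by exact_mod_cast hn
  have hd' : (1 : ℝ) ≤ d := by exact_mod_cast hd
  have hlog : 0 ≤ Real.log n := Real.log_nonneg hn'
  have h1 : Real.log (2 * n + 1) ≤ 2 + Real.log n := by
    calc Real.log (2 * n + 1) ≤ Real.log (3 * n) :=
          Real.log_le_log (by positivity) (by linarith)
      _ = Real.log 3 + Real.log n := Real.log_mul (by norm_num) (by positivity)
      _ ≤ 2 + Real.log n := by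
          have := Real.log_le_sub_one_of_pos (show (0 : ℝ) < 3 by norm_num)
          linarith
  have h2 : Real.log 2 ≤ 1 := by
    have := Real.log_le_sub_one_of_pos (show (0 : ℝ) < 2 by norm_num)
    linarith
  rw [Real.log_mul (by norm_num) (by positivity), Real.log_pow]
  push_cast
  have h3 : ((d : ℝ) + 2) * Real.log (2 * n + 1) ≤ (d + 2) * (2 + Real.log n) := by gcongr
  nlinarith [mul_nonneg (sub_nonneg.2 hd') hlog]

theorem mainTheorem7 :
    ∃ c : ℝ, 0 < c ∧ ∀ n d : ℕ, 1 ≤ n → 1 ≤ d →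
      ∃ x : Fin n → UnitSphere d, Function.Injective x ∧
        starDiscrepancy (sphericalCaps d) (sphereProb d) x ≤
          c * ((√(d : ℝ) + √(((d : ℝ) + 1) * Real.log (n : ℝ))) / √(n : ℝ)) := by
  refine ⟨9 / 2, by norm_num, fun n d hn hd => ?_⟩
  have : NeZero d := ⟨by omega⟩
  have hn' : (1 : ℝ) ≤ n := by exact_mod_cast hn
  have hd' : (1 : ℝ) ≤ d := by exact_mod_cast hd
  have hlog : 0 ≤ Real.log n := Real.log_nonneg hn'
  set M : ℝ := d + (d + 1) * Real.log n
  have hM0 : 0 < M := by positivity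
  set r : ℝ := √M
  set q : ℝ := √(n : ℝ)
  have hr0 : 0 < r := Real.sqrt_pos.2 hM0
  have hq0 : 0 < q := Real.sqrt_pos.2 (by linarith)
  have hr2 : r ^ 2 = M := Real.sq_sqrt hM0.le
  have hq2 : q ^ 2 = n := Real.sq_sqrt (by linarith)
  -- This `l` balances the two terms up to a constant: the numerator is at most `9 * M + 9 / 2 * M`,
  -- and division by `l` gives `9 / 2 * r * q`, hence the constant `9 / 2`.
  obtain ⟨x, hx, hxle⟩ := exists_injective_abs_centered_count_le n d
    (l := 3 * r / q) (by positivity)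
  refine ⟨x, hx, ?_⟩
  have hrle : r ≤ √(d : ℝ) + √(((d : ℝ) + 1) * Real.log n) := by
    refine Real.sqrt_le_iff.2 ⟨by positivity, ?_⟩
    rw [add_sq, Real.sq_sqrt (by positivity), Real.sq_sqrt (by positivity)]
    have : 0 ≤ 2 * √(d : ℝ) * √(((d : ℝ) + 1) * Real.log n) := by positivity
    linarith
  have hcount : (Real.log (2 * (2 * n + 1) ^ (d + 2)) + (3 * r / q) ^ 2 * n / 2) /
      (3 * r / q) ≤ 9 / 2 * r * q := by
    rw [div_le_iff₀ (by positivity)]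
    have h1 : (3 * r / q) ^ 2 * n / 2 = 9 / 2 * M := by
      rw [← hq2, ← hr2]; field_simp; norm_num
    have h2 : 9 / 2 * r * q * (3 * r / q) = 27 / 2 * M := by
      rw [← hr2]; field_simp; ring
    rw [h1, h2]
    linarith [log_two_mul_pow_le hn hd]
  refine Real.iSup_le ?_ (by positivity)
  rintro ⟨_, v, t, _, _, rfl⟩
  have h := (hxle (v, t)).trans hcount
  have heq : (1 / (n : ℝ)) * ∑ i, (sphericalCap v t).indicator (fun _ => (1 : ℝ)) (x i) -
      (sphereProb d).real (sphericalCap v t) =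
      (1 / (n : ℝ)) * ∑ i, ((sphereHalfspace ((v : EuclideanSpace ℝ (Fin (d + 1))), t)).indicator
        (fun _ => (1 : ℝ)) (x i) - (sphereProb d).real
          (sphereHalfspace ((v : EuclideanSpace ℝ (Fin (d + 1))), t))) := by
    change _ = (1 / (n : ℝ)) * ∑ i, ((sphericalCap v t).indicator (fun _ => (1 : ℝ)) (x i) -
      (sphereProb d).real (sphericalCap v t))
    rw [Finset.sum_sub_distrib, mul_sub]
    simp only [Finset.sum_const, Finset.card_univ, Fintype.card_fin, nsmul_eq_mul]
    field_simp
  rw [heq, abs_mul, abs_of_nonneg (by positivity)]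
  calc 1 / (n : ℝ) * _ ≤ 1 / (n : ℝ) * (9 / 2 * r * q) := by gcongr
    _ = 9 / 2 * (r / q) := by rw [← hq2]; field_simp
    _ ≤ _ := by gcongr
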